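/- Let $\mathcal K^n$ be the set of convex bodies (non-empty compact convex sets) in Euclidean space $\mathbb R^n$. For $K\in\mathcal K^n$ let $W_0(K),\dots,W_n(K)$ be its quermassintegrals, that is, the coefficients in the Steiner formula $$\mathrm{vol}(K+\lambda B_2^n)=\sum_{i=0}^n\binom{n}{i}W_i(K)\,\lambda^i\qquad(\lambda\ge 0),$$ where $B_2^n$ is the closed Euclidean unit ball; let $\kappa_i=\mathrm{vol}(B_2^i)$, let $V_i(K)=\binom{n}{i}W_{n-i}(K)/\kappa_{n-i}$, $0\le i\le n$, be the intrinsic volumes of $K$, and let $\mathcal W(K)=\sum_{i=0}^nV_i(K)$ be the Wills functional of $K$. **Theorem.** Let $K\in\mathcal K^n$ with $0\in K$ and let $H$ be a $k$-dimensional linear subspace of $\mathbb R^n$. Then $$\mathcal W(P_HK)\,\mathcal W(K\cap H^\perp)\le\min\left\{\binom{n}{k}\mathcal W(K),\;2^{n/2}\,\mathcal W\bigl(\sqrt2\,K\bigr)\right\},$$ where $P_HK$ is the orthogonal projection of $K$ onto $H$ and $H^\perp$ is the orthogonal complement of $H$. -/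

import Mathlib

open MeasureTheory
open scoped Pointwise

/-- `κ_i`, the volume of the closed unit ball of `ℝ^i`. -/
noncomputable def ballVolume (i : ℕ) : ℝ :=
  volume.real (Metric.closedBall (0 : EuclideanSpace ℝ (Fin i)) 1)

/-- The numbers `W i`, `0 ≤ i ≤ n`, are the coefficients in the Steiner formula
`vol (K + t B) = ∑_{i=0}^n (n choose i) W_i t^i`, for all `t ≥ 0`, where `B` is the closed
Euclidean unit ball of `ℝ^n`; the sequence is continued by zero beyond `n`. At most one sequence
has this property, and for a convex body one exists. -/
def SteinerFormula {n : ℕ} (K : Set (EuclideanSpace ℝ (Fin n))) (W : ℕ → ℝ) : Prop :=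
  (∀ i, n < i → W i = 0) ∧
    ∀ t : ℝ, 0 ≤ t →
      volume.real (K + t • Metric.closedBall (0 : EuclideanSpace ℝ (Fin n)) 1) =
        ∑ i ∈ Finset.range (n + 1), (n.choose i : ℝ) * W i * t ^ i

open Classical in
/-- The quermassintegrals `W_0(K), …, W_n(K)` of `K ⊆ ℝ^n` (with respect to the unit ball):
the coefficients in its Steiner formula. The value `0` is used only for sets `K` which have no
Steiner formula, hence never for a convex body. -/
noncomputable def quermassintegral {n : ℕ} (K : Set (EuclideanSpace ℝ (Fin n))) : ℕ → ℝ :=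
  if h : ∃ W : ℕ → ℝ, SteinerFormula K W then h.choose else 0

/-- The intrinsic volume `V_i(K) = (n choose i) / κ_{n-i} * W_{n-i}(K)`, used for `0 ≤ i ≤ n`. -/
noncomputable def intrinsicVolume {n : ℕ} (i : ℕ) (K : Set (EuclideanSpace ℝ (Fin n))) : ℝ :=
  (n.choose i : ℝ) / ballVolume (n - i) * quermassintegral K (n - i)

/-- The Wills functional: the sum of the intrinsic volumes `V_0(K), …, V_n(K)`. -/
noncomputable def willsFunctional {n : ℕ} (K : Set (EuclideanSpace ℝ (Fin n))) : ℝ :=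
  ∑ i ∈ Finset.range (n + 1), intrinsicVolume i K

/-! The key is Hadwiger's formula `W(K) = ∫ exp(-π d(x,K)²) dx`. Let `μ` have density `2πt
exp(-πt²)` on `t > 0`. Its tail is `μ([d,∞)) = exp(-πd²)`, so by Tonelli the integral equals `∫
vol(K + tB) dμ(t)`. The `i`-th moment of `μ` is `1/κ_i`, hence integrating Steiner's polynomial term
by term gives the sum of the intrinsic volumes (`willsIntegral_eq_willsFunctional`).

Since quermassintegrals are chosen as coefficients of a Steiner formula, that formula has to be
established. If `p` is the metric projection onto `K`, the map `x ↦ p x + t(x - p x)` carries the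
shell `0 < d ≤ 1` bijectively onto `0 < d ≤ t`, and its Jacobian `det(Dp + t(I - Dp))` is a
polynomial in `t`.

Binomial bound: the volumes of parallel bodies increase with `t`, so Chebyshev's integral inequality
bounds the product of two `μ`-integrals by the integral of the product; the Rogers–Shephard
section-projection inequality is then applied to each `K + tB`.

Bound with `√2 K`: the distance to `K` is convex, so `2 d((a+b)/2)² ≤ d(a)² + d(b)²`. With `a` over
a point of `H` and `b` in `Hᗮ`, Fubini bounds the product by `∫ exp(-2π d(z/2,K)²) dz`, and
rescaling finishes. -/

/-! ### Metric projection and dilation along normals -/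

section MetricProjection

open Set Filter Topology
open scoped RealInnerProductSpace NNReal ENNReal

variable {E : Type*} [NormedAddCommGroup E] [InnerProductSpace ℝ E]

/-- `p` is the metric projection onto `K`, described by its variational inequality. -/
structure IsMetricProjection (K : Set E) (p : E → E) : Prop where
  mem : ∀ x, p x ∈ K
  inner_le : ∀ x, ∀ w ∈ K, ⟪x - p x, w - p x⟫ ≤ 0

theorem exists_isMetricProjection {K : Set E} (hne : K.Nonempty) (hK : IsComplete K)
    (hc : Convex ℝ K) : ∃ p : E → E, IsMetricProjection K p := by
  choose p hp hmin using exists_norm_eq_iInf_of_complete_convex hne hK hc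
  exact ⟨p, hp, fun x => (norm_eq_iInf_iff_real_inner_le_zero hc (hp x)).1 (hmin x)⟩

namespace IsMetricProjection

variable {K : Set E} {p : E → E} (hp : IsMetricProjection K p)
include hp

theorem eq_of_inner_le {x q : E} (hq : q ∈ K) (h : ∀ w ∈ K, ⟪x - q, w - q⟫ ≤ 0) : p x = q := by
  have h1 := hp.inner_le x q hq
  have h2 := h (p x) (hp.mem x)
  have h3 : ⟪q - p x, q - p x⟫ ≤ 0 := by
    have : ⟪q - p x, q - p x⟫ = ⟪x - p x, q - p x⟫ + ⟪x - q, p x - q⟫ := by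
      rw [← neg_sub q (p x), inner_neg_right, ← sub_eq_add_neg, ← inner_sub_left]
      congr 1; abel
    linarith
  rw [real_inner_self_eq_norm_sq] at h3
  have : q - p x = 0 := norm_eq_zero.1 (by nlinarith [norm_nonneg (q - p x)])
  exact (sub_eq_zero.1 this).symm

theorem infDist_eq (x : E) : Metric.infDist x K = ‖x - p x‖ := by
  apply le_antisymm
  · rw [← dist_eq_norm]; exact Metric.infDist_le_dist_of_mem (hp.mem x)
  · rw [Metric.le_infDist ⟨_, hp.mem x⟩]
    intro w hw
    rw [dist_eq_norm]
    have h1 := hp.inner_le x w hw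
    have h2 : ‖x - w‖ ^ 2 = ‖x - p x‖ ^ 2 - 2 * ⟪x - p x, w - p x⟫ + ‖w - p x‖ ^ 2 := by
      rw [← norm_sub_sq_real]; congr 2; abel
    exact abs_le_of_sq_le_sq' (by nlinarith [sq_nonneg ‖w - p x‖]) (norm_nonneg _) |>.2

/-- Add the variational inequality at `x` tested on `p y` to the one at `y` tested on `p x`. Both
the Lipschitz bound and the positivity of the Jacobian rest on this. -/
theorem inner_nonneg (x y : E) : 0 ≤ ⟪p x - p y, (x - p x) - (y - p y)⟫ := by
  have h1 := hp.inner_le x _ (hp.mem y)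
  have h2 := hp.inner_le y _ (hp.mem x)
  rw [← neg_sub (p x) (p y), inner_neg_right] at h1
  rw [inner_sub_right, real_inner_comm, real_inner_comm (y - p y)]
  linarith

theorem norm_sub_le (x y : E) : ‖p x - p y‖ ≤ ‖x - y‖ := by
  have h := hp.inner_nonneg x y
  have h2 : ‖x - y‖ ^ 2 = ‖p x - p y‖ ^ 2 + 2 * ⟪p x - p y, (x - p x) - (y - p y)⟫ +
      ‖(x - p x) - (y - p y)‖ ^ 2 := by
    rw [← norm_add_sq_real]; congr 2; abel
  exact abs_le_of_sq_le_sq' (by nlinarith [sq_nonneg ‖(x - p x) - (y - p y)‖])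
    (norm_nonneg _) |>.2

theorem lipschitz : LipschitzWith 1 p :=
  LipschitzWith.of_dist_le_mul fun x y => by
    simpa [dist_eq_norm] using hp.norm_sub_le x y

omit hp in
/-- The dilation by the factor `t` along the normals of a convex set with metric projection `p`. -/
def _root_.normalDilation (p : E → E) (t : ℝ) (x : E) : E := p x + t • (x - p x)

/-- The variational inequality is homogeneous in the normal vector `x - p x`. Consequently dilations
compose by multiplying their factors, and the factor `t⁻¹` undoes `t`. -/
theorem proj_normalDilation {t : ℝ} (ht : 0 ≤ t) (x : E) : p (normalDilation p t x) = p x := by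
  refine hp.eq_of_inner_le (hp.mem x) fun w hw => ?_
  rw [normalDilation, add_sub_cancel_left, real_inner_smul_left]
  exact mul_nonpos_of_nonneg_of_nonpos ht (hp.inner_le x w hw)

theorem normalDilation_comp {s t : ℝ} (ht : 0 ≤ t) (x : E) :
    normalDilation p s (normalDilation p t x) = normalDilation p (s * t) x := by
  conv_lhs => rw [normalDilation, hp.proj_normalDilation ht]
  rw [normalDilation, normalDilation, add_sub_cancel_left, smul_smul]

theorem infDist_normalDilation {t : ℝ} (ht : 0 ≤ t) (x : E) :
    Metric.infDist (normalDilation p t x) K = t * Metric.infDist x K := by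
  rw [hp.infDist_eq, hp.infDist_eq, hp.proj_normalDilation ht, normalDilation,
    add_sub_cancel_left, norm_smul, Real.norm_of_nonneg ht]

theorem normalDilation_image {t : ℝ} (ht : 0 < t) :
    normalDilation p t '' {x | 0 < Metric.infDist x K ∧ Metric.infDist x K ≤ 1} =
      {x | 0 < Metric.infDist x K ∧ Metric.infDist x K ≤ t} := by
  ext y
  constructor
  · rintro ⟨x, ⟨h0, h1⟩, rfl⟩
    simp only [mem_ofPred_eq]
    rw [hp.infDist_normalDilation ht.le]
    exact ⟨by positivity, by nlinarith⟩
  · rintro ⟨h0, h1⟩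
    refine ⟨normalDilation p t⁻¹ y, ?_, ?_⟩
    · simp only [mem_ofPred_eq]
      rw [hp.infDist_normalDilation (inv_nonneg.2 ht.le)]
      refine ⟨by positivity, ?_⟩
      rw [inv_mul_le_iff₀ ht]; simpa using h1
    · rw [hp.normalDilation_comp (inv_nonneg.2 ht.le), mul_inv_cancel₀ ht.ne']
      simp [normalDilation]

theorem normalDilation_injective {t : ℝ} (ht : 0 < t) :
    Function.Injective (normalDilation p t) := by
  refine Function.LeftInverse.injective (g := normalDilation p t⁻¹) fun x => ?_
  rw [hp.normalDilation_comp ht.le, inv_mul_cancel₀ ht.ne']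
  simp [normalDilation]

theorem lipschitz_normalDilation (t : ℝ) :
    ∃ C : ℝ≥0, LipschitzWith C (normalDilation p t) :=
  ⟨_, hp.lipschitz.add ((lipschitzWith_smul t).comp (LipschitzWith.id.sub hp.lipschitz))⟩

/-- Split `x - y = a + b` into the increments of `p` and of `id - p`, so that `⟪a, b⟫ ≥ 0`. The
dilation turns this into `a + t b`, and the coefficients `1`, `1 + t`, `t` of the expanded product
dominate `min 1 t` times `1`, `2`, `1`. -/
theorem inner_normalDilation_ge (t : ℝ) (x y : E) :
    min 1 t * ‖x - y‖ ^ 2 ≤ ⟪normalDilation p t x - normalDilation p t y, x - y⟫ := by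
  have h := hp.inner_nonneg x y
  set a := p x - p y
  set b := (x - p x) - (y - p y)
  have hxy : x - y = a + b := by simp only [a, b]; abel
  have hΦ : normalDilation p t x - normalDilation p t y = a + t • b := by
    simp only [a, b, normalDilation, smul_sub]; abel
  rw [hΦ, hxy, norm_add_sq_real, inner_add_left, inner_add_right, inner_add_right,
    real_inner_smul_left, real_inner_smul_left, real_inner_self_eq_norm_sq,
    real_inner_self_eq_norm_sq, real_inner_comm a b]
  have h1 : min 1 t ≤ 1 := min_le_left _ _
  have h2 : min 1 t ≤ t := min_le_right _ _
  nlinarith [mul_nonneg (sub_nonneg.2 h1) (sq_nonneg ‖a‖),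
    mul_nonneg (sub_nonneg.2 h2) (sq_nonneg ‖b‖),
    mul_nonneg (sub_nonneg.2 h1) h, mul_nonneg (sub_nonneg.2 h2) h]

end IsMetricProjection

/-- The determinant of an endomorphism with positive definite quadratic form is positive. -/
theorem LinearMap.det_pos_of_inner_pos [FiniteDimensional ℝ E] (A : E →ₗ[ℝ] E)
    (hA : ∀ v, v ≠ 0 → 0 < ⟪A v, v⟫) : 0 < LinearMap.det A := by
  -- On the segment from the identity to `A` the quadratic form stays positive definite, so the
  -- determinant never vanishes and keeps the sign it has at the identity.
  let f : ℝ → ℝ := fun s => LinearMap.det (s • A + (1 - s) • LinearMap.id)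
  have hf : Continuous f := by
    let b := Module.finBasis ℝ E
    have : f = fun s => (s • LinearMap.toMatrix b b A + (1 - s) • (1 : Matrix _ _ ℝ)).det := by
      funext s
      simp only [f]
      rw [← LinearMap.det_toMatrix b, map_add, map_smul, map_smul, LinearMap.toMatrix_id]
    rw [this]
    fun_prop
  have hne : ∀ s ∈ Set.Icc (0 : ℝ) 1, f s ≠ 0 := by
    intro s hs h0
    obtain ⟨v, hv, hv0⟩ := (LinearMap.bot_lt_ker_of_det_eq_zero h0).ne' |>
      Submodule.exists_mem_ne_zero_of_ne_bot
    rw [LinearMap.mem_ker] at hv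
    have h1 : ⟪(s • A + (1 - s) • (LinearMap.id : E →ₗ[ℝ] E)) v, v⟫ = 0 := by rw [hv, inner_zero_left]
    simp only [LinearMap.add_apply, LinearMap.smul_apply, LinearMap.id_apply, inner_add_left,
      real_inner_smul_left, real_inner_self_eq_norm_sq] at h1
    have h2 := hA v hv0
    have h3 : 0 < ‖v‖ ^ 2 := by positivity
    rcases eq_or_lt_of_le hs.1 with h | h
    · subst h; simp at h1; exact hv0 h1
    · nlinarith [hs.2, mul_pos h h2, mul_nonneg (sub_nonneg.2 hs.2) h3.le]
  by_contra hcon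
  have h0 : f 0 = 1 := by simp [f]
  have h1 : f 1 ≤ 0 := by simpa [f] using hcon
  obtain ⟨s, hs, hs0⟩ := intermediate_value_Icc' zero_le_one hf.continuousOn
    (show (0 : ℝ) ∈ Set.Icc (f 1) (f 0) from ⟨h1, by rw [h0]; exact zero_le_one⟩)
  exact hne s hs hs0

theorem inner_fderiv_ge {f : E → E} {f' : E →L[ℝ] E} {c : ℝ} {x : E}
    (hf : ∀ x y, c * ‖x - y‖ ^ 2 ≤ ⟪f x - f y, x - y⟫) (hx : HasFDerivAt f f' x) (v : E) :
    c * ‖v‖ ^ 2 ≤ ⟪f' v, v⟫ := by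
  have h1 : HasDerivAt (fun s : ℝ => f (x + s • v)) (f' v) 0 := by
    have h2 : HasDerivAt (fun s : ℝ => x + s • v) v 0 := by
      simpa using ((hasDerivAt_id (0 : ℝ)).smul_const v).const_add x
    exact HasFDerivAt.comp_hasDerivAt (0 : ℝ) (by simpa using hx) h2
  have h3 := Filter.Tendsto.inner (𝕜 := ℝ) h1.tendsto_slope_zero_right (tendsto_const_nhds (x := v))
  refine ge_of_tendsto h3 ?_
  filter_upwards [self_mem_nhdsWithin] with s hs
  have hs : (0 : ℝ) < s := hs
  have := hf (x + s • v) x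
  simp only [add_sub_cancel_left, norm_smul, real_inner_smul_right, Real.norm_of_nonneg hs.le]
    at this
  simp only [zero_add, zero_smul, add_zero, real_inner_smul_left]
  rw [le_inv_mul_iff₀ hs]
  nlinarith

/-- Volume and Hausdorff measure of full dimension have the same null sets, and a Lipschitz map
enlarges Hausdorff measure by at most a constant factor. -/
theorem LipschitzWith.addHaar_image_null [FiniteDimensional ℝ E] [MeasurableSpace E] [BorelSpace E]
    {f : E → E} {C : ℝ≥0} (hf : LipschitzWith C f) {s : Set E} (hs : volume s = 0) :
    volume (f '' s) = 0 := by
  have e1 : (volume : Measure E) ≪ Measure.hausdorffMeasure (Module.finrank ℝ E) :=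
    Measure.absolutelyContinuous_isAddHaarMeasure _ _
  have e2 : (Measure.hausdorffMeasure (Module.finrank ℝ E) : Measure E) ≪ volume :=
    Measure.absolutelyContinuous_isAddHaarMeasure _ _
  apply e1
  have := hf.hausdorffMeasure_image_le (d := Module.finrank ℝ E) (by positivity) s
  rw [e2 hs, mul_zero] at this
  exact le_antisymm this zero_le

theorem exists_polynomial_det [FiniteDimensional ℝ E] (A B : E →ₗ[ℝ] E) :
    ∃ P : Polynomial ℝ, P.natDegree ≤ Module.finrank ℝ E ∧
      ∀ t, P.eval t = LinearMap.det (A + t • B) := by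
  let b := Module.finBasis ℝ E
  refine ⟨_, (Polynomial.natDegree_det_X_add_C_le (LinearMap.toMatrix b b B)
    (LinearMap.toMatrix b b A)).trans (by simp), fun t => ?_⟩
  rw [← LinearMap.det_toMatrix b, ← Polynomial.coe_evalRingHom, RingHom.map_det]
  congr 1
  ext i j
  simp [add_comm, mul_comm t]

end MetricProjection

/-! ### Steiner's formula for compact convex sets -/

section Steiner

open Set Filter Topology
open scoped RealInnerProductSpace NNReal ENNReal

theorem Metric.mem_cthickening_iff_infDist_le {X : Type*} [PseudoMetricSpace X] {K : Set X}
    (hne : K.Nonempty) {t : ℝ} (ht : 0 ≤ t) {x : X} :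
    x ∈ Metric.cthickening t K ↔ Metric.infDist x K ≤ t := by
  rw [Metric.mem_cthickening_iff, Metric.infDist,
    ENNReal.le_ofReal_iff_toReal_le (Metric.infEDist_ne_top hne) ht]

variable {E : Type*} [NormedAddCommGroup E] [InnerProductSpace ℝ E]

/-- The weights do not depend on `P`, so the identity can be integrated over a family of polynomials
using only their values, with no regularity of the coefficients. The nodes start at `1` because the
shell formula is available only for `t > 0`. -/
theorem Polynomial.eval_eq_sum_lagrange_basis {P : Polynomial ℝ} {N : ℕ} (hP : P.natDegree ≤ N)
    (t : ℝ) :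
    P.eval t = ∑ j ∈ Finset.range (N + 1), P.eval ((j : ℝ) + 1) *
      (Lagrange.basis (Finset.range (N + 1)) (fun j : ℕ => (j : ℝ) + 1) j).eval t := by
  have hinj : Set.InjOn (fun j : ℕ => (j : ℝ) + 1) (Finset.range (N + 1)) := by
    intro i _ j _ h
    simpa using h
  have h := Lagrange.eq_interpolate (f := P) hinj (by
    rw [Finset.card_range]
    exact lt_of_le_of_lt Polynomial.degree_le_natDegree (by exact_mod_cast Nat.lt_succ_of_le hP))
  conv_lhs => rw [h, Lagrange.interpolate_apply, Polynomial.eval_finsetSum]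
  simp

variable [FiniteDimensional ℝ E] [MeasurableSpace E] [BorelSpace E]

namespace IsMetricProjection

variable {K : Set E} {p : E → E}

omit [FiniteDimensional ℝ E] [MeasurableSpace E] [BorelSpace E] in
/-- The derivative of the normal dilation by the factor `t`. -/
theorem hasFDerivAt_normalDilation {x : E} (hx : DifferentiableAt ℝ p x) (t : ℝ) :
    HasFDerivAt (normalDilation p t)
      (fderiv ℝ p x + t • (ContinuousLinearMap.id ℝ E - fderiv ℝ p x)) x :=
  hx.hasFDerivAt.add (((hasFDerivAt_id x).sub hx.hasFDerivAt).const_smul t)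

omit [MeasurableSpace E] [BorelSpace E] in
theorem det_normalDilation_pos (hp : IsMetricProjection K p) {x : E}
    (hx : DifferentiableAt ℝ p x) {t : ℝ} (ht : 0 < t) :
    0 < (fderiv ℝ p x + t • (ContinuousLinearMap.id ℝ E - fderiv ℝ p x)).det := by
  refine LinearMap.det_pos_of_inner_pos _ fun v hv => ?_
  refine lt_of_lt_of_le ?_
    (inner_fderiv_ge (hp.inner_normalDilation_ge t) (hasFDerivAt_normalDilation hx t) v)
  have := norm_pos_iff.2 hv
  have := lt_min one_pos ht
  positivity

/-- The points at distance at most one from `K` where the change of variables takes place. -/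
def shell (K : Set E) (p : E → E) : Set E :=
  {x | 0 < Metric.infDist x K ∧ Metric.infDist x K ≤ 1} ∩ {x | DifferentiableAt ℝ p x}

theorem measurableSet_shell : MeasurableSet (shell K p) := by
  refine MeasurableSet.inter (MeasurableSet.inter ?_ ?_) (measurableSet_of_differentiableAt ℝ p)
  · exact measurableSet_lt measurable_const (Metric.continuous_infDist_pt K).measurable
  · exact measurableSet_le (Metric.continuous_infDist_pt K).measurable measurable_const

/-- This is the change of variables for the injective normal dilation. By Rademacher's theorem `p`
is differentiable off a null set, and the Lipschitz dilation sends that set to a null set. -/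
theorem volume_outer_shell (hp : IsMetricProjection K p) {t : ℝ} (ht : 0 < t) :
    volume {x | 0 < Metric.infDist x K ∧ Metric.infDist x K ≤ t} =
      ∫⁻ x in shell K p, ENNReal.ofReal
        (fderiv ℝ p x + t • (ContinuousLinearMap.id ℝ E - fderiv ℝ p x)).det := by
  have h1 := lintegral_abs_det_fderiv_eq_addHaar_image volume (measurableSet_shell (K := K) (p := p))
    (fun x hx => (hasFDerivAt_normalDilation hx.2 t).hasFDerivWithinAt)
    (hp.normalDilation_injective ht).injOn
  have h2 : ∫⁻ x in shell K p, ENNReal.ofReal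
        (fderiv ℝ p x + t • (ContinuousLinearMap.id ℝ E - fderiv ℝ p x)).det =
      ∫⁻ x in shell K p, ENNReal.ofReal
        |(fderiv ℝ p x + t • (ContinuousLinearMap.id ℝ E - fderiv ℝ p x)).det| := by
    refine setLIntegral_congr_fun measurableSet_shell fun x hx => ?_
    simp only [abs_of_pos (hp.det_normalDilation_pos hx.2 ht)]
  rw [h2, h1, ← hp.normalDilation_image ht]
  apply le_antisymm
  · obtain ⟨C, hC⟩ := hp.lipschitz_normalDilation t
    have hnull : volume {x | ¬ DifferentiableAt ℝ p x} = 0 :=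
      ae_iff.1 hp.lipschitz.ae_differentiableAt
    calc volume (normalDilation p t '' {x | 0 < Metric.infDist x K ∧ Metric.infDist x K ≤ 1})
        ≤ volume (normalDilation p t '' shell K p ∪
            normalDilation p t '' {x | ¬ DifferentiableAt ℝ p x}) := by
          rw [← image_union]
          refine measure_mono (image_mono fun x hx => ?_)
          by_cases hd : DifferentiableAt ℝ p x
          · exact Or.inl ⟨hx, hd⟩
          · exact Or.inr hd
      _ ≤ _ := measure_union_le _ _
      _ = _ := by rw [hC.addHaar_image_null hnull, add_zero]
  · exact measure_mono (image_mono inter_subset_left)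

theorem volumeReal_outer_shell (hp : IsMetricProjection K p) (hK : IsCompact K) {t : ℝ}
    (ht : 0 < t) :
    IntegrableOn (fun x => (fderiv ℝ p x + t • (ContinuousLinearMap.id ℝ E - fderiv ℝ p x)).det)
      (shell K p) ∧
    volume.real {x | 0 < Metric.infDist x K ∧ Metric.infDist x K ≤ t} =
      ∫ x in shell K p, (fderiv ℝ p x + t • (ContinuousLinearMap.id ℝ E - fderiv ℝ p x)).det := by
  have hmeas : Measurable fun x =>
      (fderiv ℝ p x + t • (ContinuousLinearMap.id ℝ E - fderiv ℝ p x)).det := by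
    have : Measurable (fderiv ℝ p) := measurable_fderiv ℝ p
    exact ContinuousLinearMap.continuous_det.measurable.comp
      (this.add ((measurable_const.sub this).const_smul t))
  have hpos : 0 ≤ᵐ[volume.restrict (shell K p)] fun x =>
      (fderiv ℝ p x + t • (ContinuousLinearMap.id ℝ E - fderiv ℝ p x)).det := by
    refine (ae_restrict_iff' measurableSet_shell).2 (ae_of_all _ fun x hx => ?_)
    exact (hp.det_normalDilation_pos hx.2 ht).le
  have hv := hp.volume_outer_shell ht
  have hfin : volume {x | 0 < Metric.infDist x K ∧ Metric.infDist x K ≤ t} < ⊤ := by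
    refine lt_of_le_of_lt (measure_mono fun x hx => ?_) (hK.cthickening (r := t)).measure_lt_top
    exact (Metric.mem_cthickening_iff_infDist_le ⟨_, hp.mem x⟩ ht.le).2 hx.2
  constructor
  · refine ⟨hmeas.aestronglyMeasurable, ?_⟩
    rw [hasFiniteIntegral_iff_ofReal hpos, ← hv]
    exact hfin
  · rw [integral_eq_lintegral_of_nonneg_ae hpos hmeas.aestronglyMeasurable, ← hv]
    rfl

end IsMetricProjection

/-- The volume of the parallel bodies of a compact convex set is a polynomial. -/
theorem exists_polynomial_volume_cthickening {K : Set E} (hne : K.Nonempty) (hK : IsCompact K)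
    (hc : Convex ℝ K) :
    ∃ P : Polynomial ℝ, P.natDegree ≤ Module.finrank ℝ E ∧
      ∀ t, 0 ≤ t → volume.real (Metric.cthickening t K) = P.eval t := by
  obtain ⟨p, hp⟩ := exists_isMetricProjection hne hK.isComplete hc
  set N := Module.finrank ℝ E
  set V : ℝ → ℝ := fun t => volume.real {x | 0 < Metric.infDist x K ∧ Metric.infDist x K ≤ t}
  set ℓ : ℕ → Polynomial ℝ :=
    fun j => Lagrange.basis (Finset.range (N + 1)) (fun j : ℕ => (j : ℝ) + 1) j
  let Q : Polynomial ℝ := ∑ j ∈ Finset.range (N + 1), Polynomial.C (V ((j : ℝ) + 1)) * ℓ j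
  have hQ : ∀ t, Q.eval t = ∑ j ∈ Finset.range (N + 1), V ((j : ℝ) + 1) * (ℓ j).eval t := by
    intro t
    simp [Q, Polynomial.eval_finsetSum]
  have hQdeg : Q.natDegree ≤ N := by
    refine Polynomial.natDegree_sum_le_of_forall_le _ _ fun j hj => ?_
    refine (Polynomial.natDegree_C_mul_le _ _).trans ?_
    have hinj : Set.InjOn (fun j : ℕ => (j : ℝ) + 1) (Finset.range (N + 1)) := by
      intro i _ j _ h
      simpa using h
    have := Lagrange.degree_basis hinj hj
    rw [Finset.card_range, Nat.add_sub_cancel] at this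
    exact (Polynomial.natDegree_eq_of_degree_eq_some this).le
  have hV : ∀ t, 0 < t → V t = Q.eval t := by
    intro t ht
    have hj : ∀ j : ℕ, (0 : ℝ) < (j : ℝ) + 1 := fun j => by positivity
    have hVt : ∀ s, 0 < s → V s = _ := fun s hs => (hp.volumeReal_outer_shell hK hs).2
    rw [hQ, hVt t ht]
    simp_rw [fun j : ℕ => hVt _ (hj j), ← integral_mul_const]
    rw [← integral_finsetSum _ fun j _ =>
      ((hp.volumeReal_outer_shell hK (hj j)).1.mul_const _)]
    refine integral_congr_ae (ae_of_all _ fun x => ?_)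
    obtain ⟨R, hR, hRe⟩ := exists_polynomial_det (fderiv ℝ p x : E →ₗ[ℝ] E)
      ((ContinuousLinearMap.id ℝ E - fderiv ℝ p x : E →L[ℝ] E) : E →ₗ[ℝ] E)
    have hdet : ∀ s : ℝ, (fderiv ℝ p x + s • (ContinuousLinearMap.id ℝ E - fderiv ℝ p x)).det =
        R.eval s := fun s => (hRe s).symm
    simp only [hdet]
    exact Polynomial.eval_eq_sum_lagrange_basis hR t
  have hthick : ∀ t, 0 < t → volume.real (Metric.cthickening t K) = volume.real K + Q.eval t := by
    intro t ht
    rw [← hV t ht]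
    have hset : Metric.cthickening t K =
        K ∪ {x | 0 < Metric.infDist x K ∧ Metric.infDist x K ≤ t} := by
      ext x
      rw [Metric.mem_cthickening_iff_infDist_le hne ht.le]
      constructor
      · intro h
        by_cases hx : x ∈ K
        · exact Or.inl hx
        · exact Or.inr ⟨(hK.isClosed.notMem_iff_infDist_pos hne).1 hx, h⟩
      · rintro (h | h)
        · rw [Metric.infDist_zero_of_mem h]; exact ht.le
        · exact h.2
    have hfin := (hK.cthickening (r := t)).measure_lt_top (μ := volume)
    rw [hset] at hfin ⊢
    refine measureReal_union ?_ ?_ hK.measure_lt_top.ne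
      (ne_top_of_le_ne_top hfin.ne (measure_mono subset_union_right))
    · rw [disjoint_left]
      intro x hx hx'
      rw [mem_ofPred_eq, Metric.infDist_zero_of_mem hx] at hx'
      exact lt_irrefl _ hx'.1
    · exact (measurableSet_lt measurable_const (Metric.continuous_infDist_pt K).measurable).inter
        (measurableSet_le (Metric.continuous_infDist_pt K).measurable measurable_const)
  -- The identity for `t > 0` extends to `t = 0` because the volumes of the parallel bodies of a
  -- compact set tend to its own volume.
  have hQ0 : Q.eval 0 = 0 := by
    have h1 : Tendsto (fun t => volume.real (Metric.cthickening t K)) (𝓝[>] 0)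
        (𝓝 (volume.real K)) :=
      (ENNReal.tendsto_toReal hK.measure_lt_top.ne).comp
        ((tendsto_measure_cthickening_of_isCompact hK).mono_left nhdsWithin_le_nhds)
    have h2 : Tendsto (fun t => volume.real (Metric.cthickening t K)) (𝓝[>] 0)
        (𝓝 (volume.real K + Q.eval 0)) := by
      refine Tendsto.congr' (f₁ := fun t => volume.real K + Q.eval t) ?_ ?_
      · filter_upwards [self_mem_nhdsWithin] with t ht using (hthick t ht).symm
      · exact ((continuous_const.add Q.continuous).tendsto 0).mono_left nhdsWithin_le_nhds
    have := tendsto_nhds_unique h1 h2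
    linarith
  refine ⟨Polynomial.C (volume.real K) + Q, ?_, fun t ht => ?_⟩
  · exact (Polynomial.natDegree_add_le _ _).trans (by simpa using hQdeg)
  · rcases eq_or_lt_of_le ht with rfl | ht
    · rw [Metric.cthickening_zero, hK.isClosed.closure_eq]
      simp [hQ0]
    · simp [hthick t ht]

end Steiner

theorem exists_steinerFormula {n : ℕ} {K : Set (EuclideanSpace ℝ (Fin n))} (hne : K.Nonempty)
    (hK : IsCompact K) (hc : Convex ℝ K) : ∃ W, SteinerFormula K W := by
  obtain ⟨P, hdeg, hP⟩ := exists_polynomial_volume_cthickening hne hK hc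
  rw [finrank_euclideanSpace_fin] at hdeg
  -- For `i > n` the binomial coefficient is zero and division by zero gives the required value `0`.
  refine ⟨fun i => P.coeff i / n.choose i, fun i hi => ?_, fun t ht => ?_⟩
  · simp [Nat.choose_eq_zero_of_lt hi]
  · rw [smul_unitClosedBall, Real.norm_of_nonneg ht, hK.add_closedBall_zero ht, hP t ht,
      Polynomial.eval_eq_sum_range' (Nat.lt_succ_of_le hdeg)]
    refine Finset.sum_congr rfl fun i hi => ?_
    have : (n.choose i : ℝ) ≠ 0 := by
      exact_mod_cast (Nat.choose_pos (Nat.lt_succ_iff.1 (Finset.mem_range.1 hi))).ne'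
    field_simp

theorem steinerFormula_quermassintegral {n : ℕ} {K : Set (EuclideanSpace ℝ (Fin n))}
    (hne : K.Nonempty) (hK : IsCompact K) (hc : Convex ℝ K) :
    SteinerFormula K (quermassintegral K) := by
  have h := exists_steinerFormula hne hK hc
  rw [quermassintegral, dif_pos h]
  exact h.choose_spec

/-! ### Hadwiger's integral formula for the Wills functional -/

section WillsIntegral

open Set Filter Topology
open scoped NNReal ENNReal

/-- The probability measure with density `2πt exp(-πt²)` on the positive half-line. -/
noncomputable def rayleighMeasure : Measure ℝ :=
  (volume.restrict (Ioi 0)).withDensity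
    fun t => ENNReal.ofReal (2 * Real.pi * t * Real.exp (-Real.pi * t ^ 2))

instance : SFinite rayleighMeasure := by
  unfold rayleighMeasure; infer_instance

theorem ae_rayleighMeasure_pos : ∀ᵐ t ∂rayleighMeasure, 0 < t :=
  (withDensity_absolutelyContinuous _ _).ae_le (ae_restrict_mem measurableSet_Ioi)

/-- The density has the antiderivative `-exp(-πt²)`; it is chosen for this tail. -/
theorem rayleighMeasure_Ici {d : ℝ} (hd : 0 ≤ d) :
    rayleighMeasure (Ici d) = ENNReal.ofReal (Real.exp (-Real.pi * d ^ 2)) := by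
  have hderiv : ∀ t ∈ Ici d, HasDerivAt (fun t : ℝ => -Real.exp (-Real.pi * t ^ 2))
      (2 * Real.pi * t * Real.exp (-Real.pi * t ^ 2)) t := by
    intro t _
    have h := (((hasDerivAt_pow 2 t).const_mul (-Real.pi)).exp).neg
    have e : 2 * Real.pi * t * Real.exp (-Real.pi * t ^ 2) =
        -(Real.exp (-Real.pi * t ^ 2) * (-Real.pi * (((2 : ℕ) : ℝ) * t ^ (2 - 1)))) := by
      push_cast; ring
    rw [e]
    exact h
  have hnonneg : ∀ t ∈ Ioi d, 0 ≤ 2 * Real.pi * t * Real.exp (-Real.pi * t ^ 2) := by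
    intro t ht
    have : 0 < t := lt_of_le_of_lt hd ht
    positivity
  have hlim : Tendsto (fun t : ℝ => -Real.exp (-Real.pi * t ^ 2)) atTop (𝓝 0) := by
    rw [← neg_zero]
    refine (Real.tendsto_exp_atBot.comp ?_).neg
    exact (tendsto_pow_atTop two_ne_zero).const_mul_atTop_of_neg (neg_lt_zero.2 Real.pi_pos)
  have hint := integral_Ioi_of_hasDerivAt_of_nonneg' hderiv hnonneg hlim
  have hI := integrableOn_Ioi_deriv_of_nonneg' hderiv hnonneg hlim
  rw [rayleighMeasure, withDensity_apply _ measurableSet_Ici,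
    Measure.restrict_restrict measurableSet_Ici]
  have hset : (Ici d ∩ Ioi 0 : Set ℝ) =ᵐ[volume] Ioi d := by
    have : (Ici d ∩ Ioi 0 : Set ℝ) =ᵐ[volume] (Ioi d ∩ Ioi 0 : Set ℝ) :=
      Ioi_ae_eq_Ici.symm.inter (ae_eq_refl _)
    rwa [inter_eq_left.2 (Ioi_subset_Ioi hd)] at this
  rw [setLIntegral_congr hset, ← ofReal_integral_eq_lintegral_ofReal hI
    ((ae_restrict_iff' measurableSet_Ioi).2 (ae_of_all _ hnonneg)), hint]
  simp

instance : IsProbabilityMeasure rayleighMeasure := by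
  constructor
  have h := rayleighMeasure_Ici le_rfl
  have h0 : rayleighMeasure univ = rayleighMeasure (Ici 0) :=
    measure_congr (by filter_upwards [ae_rayleighMeasure_pos] with t ht
                      exact propext ⟨fun _ => ht.le, fun _ => trivial⟩)
  rw [h0, h]; simp

section Integral

variable {E : Type*} [NormedAddCommGroup E] [InnerProductSpace ℝ E] [FiniteDimensional ℝ E]
  [MeasurableSpace E] [BorelSpace E]

/-- The integral of `exp(-π d(x, K)²)` over the whole space. -/
noncomputable def willsIntegral (K : Set E) : ℝ≥0∞ :=
  ∫⁻ x, ENNReal.ofReal (Real.exp (-Real.pi * Metric.infDist x K ^ 2))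

theorem monotone_volume_cthickening (K : Set E) :
    Monotone fun t => volume (Metric.cthickening t K) :=
  fun _ _ h => measure_mono (Metric.cthickening_mono h K)

/-- Layer cake: measure the set `{(x, t) | d(x, K) ≤ t}` by slicing in either variable. -/
theorem willsIntegral_eq_lintegral {K : Set E} (hne : K.Nonempty) :
    willsIntegral K = ∫⁻ t, volume (Metric.cthickening t K) ∂rayleighMeasure := by
  have hS : MeasurableSet {z : E × ℝ | Metric.infDist z.1 K ≤ z.2} :=
    measurableSet_le ((Metric.continuous_infDist_pt K).measurable.comp measurable_fst)
      measurable_snd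
  have h1 := Measure.prod_apply (μ := (volume : Measure E)) (ν := rayleighMeasure) hS
  have h2 := Measure.prod_apply_symm (μ := (volume : Measure E)) (ν := rayleighMeasure) hS
  rw [h2] at h1
  rw [willsIntegral]
  trans ∫⁻ x : E, rayleighMeasure (Prod.mk x ⁻¹' {z : E × ℝ | Metric.infDist z.1 K ≤ z.2})
  · exact lintegral_congr fun x => (rayleighMeasure_Ici Metric.infDist_nonneg).symm
  · rw [← h1]
    refine lintegral_congr_ae ?_
    filter_upwards [ae_rayleighMeasure_pos] with t ht
    congr 1
    ext x
    exact (Metric.mem_cthickening_iff_infDist_le hne ht.le).symm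

variable (E) in
theorem lintegral_exp_neg_pi_norm_sq :
    ∫⁻ x : E, ENNReal.ofReal (Real.exp (-Real.pi * ‖x‖ ^ 2)) = 1 := by
  have h := GaussianFourier.integral_rexp_neg_mul_sq_norm (V := E) Real.pi_pos
  rw [div_self Real.pi_pos.ne', Real.one_rpow] at h
  rw [← ofReal_integral_eq_lintegral_ofReal _ (ae_of_all _ fun _ => (Real.exp_pos _).le), h,
    ENNReal.ofReal_one]
  exact Integrable.of_integral_ne_zero (by rw [h]; exact one_ne_zero)

end Integral

theorem ballVolume_pos (i : ℕ) : 0 < ballVolume i :=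
  ENNReal.toReal_pos (Metric.measure_closedBall_pos _ _ one_pos).ne'
    measure_closedBall_lt_top.ne

/-- Apply the layer-cake formula to a point of `ℝ^i`: the Gaussian has mass one, while the parallel
bodies are balls of volume `κ_i t^i`. -/
theorem lintegral_pow_rayleighMeasure (i : ℕ) :
    ∫⁻ t, ENNReal.ofReal (t ^ i) ∂rayleighMeasure = ENNReal.ofReal (1 / ballVolume i) := by
  have h1 : willsIntegral ({0} : Set (EuclideanSpace ℝ (Fin i))) = 1 := by
    simpa [willsIntegral] using lintegral_exp_neg_pi_norm_sq (EuclideanSpace ℝ (Fin i))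
  rw [willsIntegral_eq_lintegral (singleton_nonempty _)] at h1
  have h2 : ∫⁻ t, volume (Metric.cthickening t ({0} : Set (EuclideanSpace ℝ (Fin i))))
      ∂rayleighMeasure =
      ∫⁻ t, ENNReal.ofReal (t ^ i) * ENNReal.ofReal (ballVolume i) ∂rayleighMeasure := by
    refine lintegral_congr_ae ?_
    filter_upwards [ae_rayleighMeasure_pos] with t ht
    rw [Metric.cthickening_singleton _ ht.le, Measure.addHaar_closedBall' _ _ ht.le,
      finrank_euclideanSpace_fin, ballVolume, Measure.real,
      ENNReal.ofReal_toReal measure_closedBall_lt_top.ne]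
  rw [h2, lintegral_mul_const' _ _ ENNReal.ofReal_ne_top] at h1
  rw [one_div, ENNReal.ofReal_inv_of_pos (ballVolume_pos i)]
  exact ENNReal.eq_inv_of_mul_eq_one_left h1

theorem integral_pow_rayleighMeasure (i : ℕ) :
    Integrable (fun t : ℝ => t ^ i) rayleighMeasure ∧
      ∫ t, t ^ i ∂rayleighMeasure = 1 / ballVolume i := by
  have hpos : 0 ≤ᵐ[rayleighMeasure] fun t : ℝ => t ^ i := by
    filter_upwards [ae_rayleighMeasure_pos] with t ht using pow_nonneg ht.le i
  have hm : AEStronglyMeasurable (fun t : ℝ => t ^ i) rayleighMeasure := by fun_prop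
  refine ⟨⟨hm, ?_⟩, ?_⟩
  · rw [hasFiniteIntegral_iff_ofReal hpos, lintegral_pow_rayleighMeasure]
    exact ENNReal.ofReal_lt_top
  · rw [integral_eq_lintegral_of_nonneg_ae hpos hm, lintegral_pow_rayleighMeasure,
      ENNReal.toReal_ofReal (one_div_nonneg.2 (ballVolume_pos i).le)]

/-- Integrating Steiner's polynomial, the moment `1/κ_i` turns the term with `W_i` into `V_{n-i}`;
hence the reversal of the sum. -/
theorem willsIntegral_eq_willsFunctional {n : ℕ} {K : Set (EuclideanSpace ℝ (Fin n))}
    (hne : K.Nonempty) (hK : IsCompact K) (hc : Convex ℝ K) :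
    0 ≤ willsFunctional K ∧ willsIntegral K = ENNReal.ofReal (willsFunctional K) := by
  have hW := (steinerFormula_quermassintegral hne hK hc).2
  set W := quermassintegral K with hWdef
  have hpoly : ∀ t, 0 < t → volume.real (Metric.cthickening t K) =
      ∑ i ∈ Finset.range (n + 1), (n.choose i : ℝ) * W i * t ^ i := by
    intro t ht
    rw [← hW t ht.le, smul_unitClosedBall, Real.norm_of_nonneg ht.le, hK.add_closedBall_zero ht.le]
  have hae : (fun t => volume.real (Metric.cthickening t K)) =ᵐ[rayleighMeasure]
      fun t => ∑ i ∈ Finset.range (n + 1), (n.choose i : ℝ) * W i * t ^ i := by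
    filter_upwards [ae_rayleighMeasure_pos] with t ht using hpoly t ht
  have hterm : ∀ i ∈ Finset.range (n + 1),
      Integrable (fun t : ℝ => (n.choose i : ℝ) * W i * t ^ i) rayleighMeasure :=
    fun i _ => (integral_pow_rayleighMeasure i).1.const_mul _
  have hint : Integrable (fun t => volume.real (Metric.cthickening t K)) rayleighMeasure :=
    (integrable_congr hae).2 (integrable_finsetSum _ hterm)
  have hval : ∫ t, volume.real (Metric.cthickening t K) ∂rayleighMeasure = willsFunctional K := by
    rw [integral_congr_ae hae, integral_finsetSum _ hterm, willsFunctional,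
      ← Finset.sum_range_reflect]
    refine Finset.sum_congr rfl fun i hi => ?_
    have hi : i ≤ n := Nat.lt_succ_iff.1 (Finset.mem_range.1 hi)
    have e1 : n + 1 - 1 - i = n - i := by omega
    rw [integral_const_mul, (integral_pow_rayleighMeasure _).2, intrinsicVolume, e1, ← hWdef,
      Nat.choose_symm hi]
    ring
  refine ⟨hval ▸ integral_nonneg fun t => measureReal_nonneg, ?_⟩
  rw [willsIntegral_eq_lintegral hne, ← hval,
    ofReal_integral_eq_lintegral_ofReal hint (ae_of_all _ fun t => measureReal_nonneg)]
  exact lintegral_congr fun t => (ENNReal.ofReal_toReal hK.cthickening.measure_lt_top.ne).symm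

end WillsIntegral

/-! ### Orthogonal splitting and the bound with `√2 K` -/

section Decomposition

open Set Filter Topology
open scoped NNReal ENNReal

variable {E : Type*} [NormedAddCommGroup E] [InnerProductSpace ℝ E] [FiniteDimensional ℝ E]

theorem Submodule.coe_orthogonalProjectionOnto_add (U : Submodule ℝ E) (z : E) :
    ((U.orthogonalProjectionOnto z : E) + (Uᗮ.orthogonalProjectionOnto z : E)) = z :=
  U.starProjection_add_starProjection_orthogonal z

omit [FiniteDimensional ℝ E] in
theorem Submodule.norm_coe_add_coe_sq (U : Submodule ℝ E) (x : U) (y : Uᗮ) :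
    ‖(x : E) + y‖ ^ 2 = ‖x‖ ^ 2 + ‖y‖ ^ 2 := by
  have h := norm_add_sq_eq_norm_sq_add_norm_sq_of_inner_eq_zero (x : E) (y : E)
    (Submodule.inner_right_of_mem_orthogonal (𝕜 := ℝ) x.2 y.2)
  simpa [sq] using h

omit [FiniteDimensional ℝ E] in
-- Pythagoras holds for the distance to each point of `P`, and the term `‖y‖²` does not affect the
-- minimisation.
theorem infDist_coe_image_sq (U : Submodule ℝ E) {P : Set U} (hne : P.Nonempty)
    (hP : IsCompact P) (x : U) (y : Uᗮ) :
    Metric.infDist ((x : E) + y) ((↑) '' P) ^ 2 = Metric.infDist x P ^ 2 + ‖y‖ ^ 2 := by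
  have hd : ∀ p : U, dist ((x : E) + y) p ^ 2 = dist x p ^ 2 + ‖y‖ ^ 2 := by
    intro p
    rw [dist_eq_norm, dist_eq_norm, ← U.norm_coe_add_coe_sq, Submodule.coe_sub]
    congr 2; abel
  apply le_antisymm
  · obtain ⟨p, hp, hdp⟩ := hP.exists_infDist_eq_dist hne x
    rw [hdp, ← hd]
    gcongr
    · exact Metric.infDist_nonneg
    · exact Metric.infDist_le_dist_of_mem (mem_image_of_mem _ hp)
  · obtain ⟨_, ⟨p, hp, rfl⟩, hdp⟩ :=
      (hP.image continuous_subtype_val).exists_infDist_eq_dist (hne.image _) ((x : E) + y)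
    rw [hdp, hd]
    gcongr
    · exact Metric.infDist_nonneg
    · exact Metric.infDist_le_dist_of_mem hp

omit [FiniteDimensional ℝ E] in
theorem infDist_midpoint_le {K : Set E} (hne : K.Nonempty) (hK : IsCompact K) (hc : Convex ℝ K)
    (a b : E) :
    Metric.infDist ((1 / 2 : ℝ) • (a + b)) K ≤ (Metric.infDist a K + Metric.infDist b K) / 2 := by
  obtain ⟨p, hp, hap⟩ := hK.exists_infDist_eq_dist hne a
  obtain ⟨q, hq, hbq⟩ := hK.exists_infDist_eq_dist hne b
  have hm : (1 / 2 : ℝ) • p + (1 / 2 : ℝ) • q ∈ K :=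
    hc hp hq (by norm_num) (by norm_num) (by norm_num)
  refine (Metric.infDist_le_dist_of_mem hm).trans ?_
  rw [hap, hbq, dist_eq_norm, dist_eq_norm, dist_eq_norm]
  have : (1 / 2 : ℝ) • (a + b) - ((1 / 2 : ℝ) • p + (1 / 2 : ℝ) • q) =
      (1 / 2 : ℝ) • ((a - p) + (b - q)) := by
    module
  rw [this, norm_smul, Real.norm_of_nonneg (by norm_num)]
  have := norm_add_le (a - p) (b - q)
  linarith

variable [MeasurableSpace E] [BorelSpace E]

theorem Submodule.measurePreserving_orthogonalProjectionOnto_prod (U : Submodule ℝ E) :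
    MeasurePreserving
      (fun z => (U.orthogonalProjectionOnto z, Uᗮ.orthogonalProjectionOnto z))
      (volume : Measure E) ((volume : Measure U).prod (volume : Measure Uᗮ)) := by
  have h := (WithLp.volume_preserving_ofLp U Uᗮ).comp U.orthogonalDecomposition.measurePreserving
  have e : (WithLp.ofLp ∘ U.orthogonalDecomposition : E → U × Uᗮ) =
      fun z => (U.orthogonalProjectionOnto z, Uᗮ.orthogonalProjectionOnto z) := by
    funext z
    exact Prod.ext (U.fst_orthogonalDecomposition_apply z) (U.snd_orthogonalDecomposition_apply z)
  rwa [e] at h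

theorem lintegral_eq_lintegral_orthogonal (U : Submodule ℝ E) {f : E → ℝ≥0∞} (hf : Measurable f) :
    ∫⁻ z, f z = ∫⁻ x : U, ∫⁻ y : Uᗮ, f ((x : E) + y) := by
  have hmp := U.measurePreserving_orthogonalProjectionOnto_prod
  have hg : Measurable fun w : U × Uᗮ => f ((w.1 : E) + w.2) := by
    refine hf.comp ?_
    fun_prop
  rw [← lintegral_prod (f := fun w : U × Uᗮ => f ((w.1 : E) + w.2)) hg.aemeasurable,
    ← hmp.lintegral_comp hg]
  refine lintegral_congr fun z => ?_
  simp only [U.coe_orthogonalProjectionOnto_add z]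

omit [InnerProductSpace ℝ E] [FiniteDimensional ℝ E] in
theorem measurable_exp_infDist (c : ℝ) (K : Set E) :
    Measurable fun x : E => ENNReal.ofReal (Real.exp (c * Metric.infDist x K ^ 2)) := by
  have := (Metric.continuous_infDist_pt K).measurable
  fun_prop

/-- The Wills integral does not depend on the dimension of the ambient space. -/
theorem willsIntegral_coe_image (U : Submodule ℝ E) {P : Set U} (hne : P.Nonempty)
    (hP : IsCompact P) : willsIntegral ((↑) '' P : Set E) = willsIntegral P := by
  rw [willsIntegral, lintegral_eq_lintegral_orthogonal U (measurable_exp_infDist _ _)]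
  refine lintegral_congr fun x => ?_
  simp_rw [infDist_coe_image_sq U hne hP, mul_add, Real.exp_add,
    ENNReal.ofReal_mul (Real.exp_pos _).le]
  rw [lintegral_const_mul' _ _ ENNReal.ofReal_ne_top, lintegral_exp_neg_pi_norm_sq, mul_one]

omit [MeasurableSpace E] [BorelSpace E] in
-- Take `q ∈ K` whose projection is nearest to `x`, and let `v` be its component in `Uᗮ`; then `x +
-- v` and `q` differ only inside `U`.
theorem exists_infDist_add_le (U : Submodule ℝ E) {K : Set E} (hne : K.Nonempty)
    (hK : IsCompact K) (x : U) :
    ∃ v : Uᗮ, Metric.infDist ((x : E) + v) K ≤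
      Metric.infDist x (U.orthogonalProjectionOnto '' K) := by
  obtain ⟨_, ⟨q, hq, rfl⟩, hd⟩ := (hK.image
    U.orthogonalProjectionOnto.continuous).exists_infDist_eq_dist (hne.image _) x
  refine ⟨Uᗮ.orthogonalProjectionOnto q, ?_⟩
  rw [hd]
  refine (Metric.infDist_le_dist_of_mem hq).trans (le_of_eq ?_)
  rw [dist_eq_norm, dist_eq_norm]
  nth_rw 2 [← U.coe_orthogonalProjectionOnto_add q]
  rw [add_sub_add_right_eq_sub, ← Submodule.coe_sub, Submodule.coe_norm]

/-- For fixed `x`, take the midpoint of `x + v` and `y`, with `v` the lift of `x` that does not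
increase the distance. Convexity gives `d ≤ (a + b)/2`, hence `2d² ≤ a² + b²`; the shift of `y` by
`v` does not change the integral over `Uᗮ`. -/
theorem willsIntegral_projection_mul_section_le (U : Submodule ℝ E) {K : Set E}
    (hK : IsCompact K) (hc : Convex ℝ K)
    (hQ : ((↑) ⁻¹' K : Set Uᗮ).Nonempty) :
    willsIntegral (U.orthogonalProjectionOnto '' K) * willsIntegral ((↑) ⁻¹' K : Set Uᗮ) ≤
      ∫⁻ z : E, ENNReal.ofReal
        (Real.exp (-(2 * Real.pi) * Metric.infDist ((1 / 2 : ℝ) • z) K ^ 2)) := by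
  have hne : K.Nonempty := ⟨_, hQ.some_mem⟩
  have hm : Measurable fun z : E => ENNReal.ofReal
      (Real.exp (-(2 * Real.pi) * Metric.infDist ((1 / 2 : ℝ) • z) K ^ 2)) :=
    (measurable_exp_infDist (-(2 * Real.pi)) K).comp (measurable_const_smul (1 / 2 : ℝ))
  rw [lintegral_eq_lintegral_orthogonal U hm]
  conv_lhs => rw [willsIntegral]
  rw [← lintegral_mul_const _ (measurable_exp_infDist _ _)]
  refine lintegral_mono fun x => ?_
  obtain ⟨v, hv⟩ := exists_infDist_add_le U hne hK x
  rw [willsIntegral, ← lintegral_const_mul _ (measurable_exp_infDist _ _),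
    ← lintegral_add_left_eq_self (fun y : Uᗮ => ENNReal.ofReal (Real.exp
      (-(2 * Real.pi) * Metric.infDist ((1 / 2 : ℝ) • ((x : E) + y)) K ^ 2))) v]
  refine lintegral_mono fun y => ?_
  dsimp only
  rw [← ENNReal.ofReal_mul (Real.exp_pos _).le, ← Real.exp_add]
  refine ENNReal.ofReal_le_ofReal (Real.exp_le_exp.2 ?_)
  have h1 : Metric.infDist (y : E) K ≤ Metric.infDist y ((↑) ⁻¹' K : Set Uᗮ) := by
    rw [Metric.le_infDist hQ]
    intro q hq
    exact Metric.infDist_le_dist_of_mem hq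
  have h2 := infDist_midpoint_le hne hK hc ((x : E) + v) (y : E)
  rw [show ((x : E) + v) + y = (x : E) + ((v + y : Uᗮ) : E) by
    rw [Submodule.coe_add, add_assoc]] at h2
  have h0 := Metric.infDist_nonneg (x := (1 / 2 : ℝ) • ((x : E) + ((v + y : Uᗮ) : E))) (s := K)
  set d := Metric.infDist ((1 / 2 : ℝ) • ((x : E) + ((v + y : Uᗮ) : E))) K
  set a := Metric.infDist x (U.orthogonalProjectionOnto '' K)
  set b := Metric.infDist y ((↑) ⁻¹' K : Set Uᗮ)
  have h3 : d ≤ (a + b) / 2 := by linarith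
  have h4 : 2 * d ^ 2 ≤ a ^ 2 + b ^ 2 := by
    nlinarith [sq_nonneg (a - b), mul_self_le_mul_self h0 h3]
  nlinarith [Real.pi_pos]

/-- Since `√2 d(z/2, K) = d(z/√2, √2 K)`, the substitution `w = z/√2` produces the factor `√2` to
the power of the dimension. -/
theorem lintegral_exp_infDist_half (K : Set E) :
    ∫⁻ z : E, ENNReal.ofReal
        (Real.exp (-(2 * Real.pi) * Metric.infDist ((1 / 2 : ℝ) • z) K ^ 2)) =
      ENNReal.ofReal ((2 : ℝ) ^ ((Module.finrank ℝ E : ℝ) / 2)) *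
        willsIntegral (Real.sqrt 2 • K) := by
  have h2 : (0 : ℝ) < Real.sqrt 2 := by positivity
  have hs : (Real.sqrt 2)⁻¹ ≠ 0 := inv_ne_zero h2.ne'
  have hpt : ∀ z : E, ENNReal.ofReal
        (Real.exp (-(2 * Real.pi) * Metric.infDist ((1 / 2 : ℝ) • z) K ^ 2)) =
      ENNReal.ofReal (Real.exp
        (-Real.pi * Metric.infDist ((Real.sqrt 2)⁻¹ • z) (Real.sqrt 2 • K) ^ 2)) := by
    intro z
    have : (Real.sqrt 2)⁻¹ • z = Real.sqrt 2 • ((1 / 2 : ℝ) • z) := by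
      rw [smul_smul]
      congr 1
      field_simp
      rw [Real.sq_sqrt (by norm_num)]
    rw [this, infDist_smul₀ h2.ne', Real.norm_of_nonneg h2.le, mul_pow,
      Real.sq_sqrt (by norm_num)]
    congr 2; ring
  simp_rw [hpt]
  rw [← lintegral_map (f := fun w : E => ENNReal.ofReal (Real.exp
        (-Real.pi * Metric.infDist w (Real.sqrt 2 • K) ^ 2)))
    (measurable_exp_infDist _ _) (measurable_const_smul (Real.sqrt 2)⁻¹),
    Measure.map_addHaar_smul _ hs, lintegral_smul_measure, smul_eq_mul, willsIntegral]
  congr 2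
  rw [inv_pow, inv_inv, abs_of_pos (by positivity), Real.sqrt_eq_rpow, ← Real.rpow_natCast,
    ← Real.rpow_mul (by norm_num)]
  congr 1; ring

end Decomposition

/-! ### The Rogers–Shephard inequality -/

section RogersShephard

open Set Filter Topology
open scoped NNReal ENNReal

/-- Beta integral: integration by parts trades a factor `1 - x` for a factor `x`, and the binomial
coefficients change by the matching ratio. -/
theorem integral_pow_mul_one_sub_pow (j k : ℕ) :
    ((j : ℝ) + 1) * ((k + j + 1).choose k : ℝ) * ∫ x in (0 : ℝ)..1, x ^ k * (1 - x) ^ j = 1 := by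
  induction j generalizing k with
  | zero =>
    simp
    field_simp
  | succ j ih =>
    have hparts : (((k : ℝ) + 1) * ∫ x in (0 : ℝ)..1, x ^ k * (1 - x) ^ (j + 1)) -
        (((j : ℝ) + 1) * ∫ x in (0 : ℝ)..1, x ^ (k + 1) * (1 - x) ^ j) = 0 := by
      rw [← intervalIntegral.integral_const_mul, ← intervalIntegral.integral_const_mul,
        ← intervalIntegral.integral_sub
          (Continuous.intervalIntegrable (by fun_prop) _ _)
          (Continuous.intervalIntegrable (by fun_prop) _ _),
        intervalIntegral.integral_eq_sub_of_hasDerivAt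
          (f := fun x : ℝ => x ^ (k + 1) * (1 - x) ^ (j + 1))]
      · simp
      · intro x _
        have h := (hasDerivAt_pow (k + 1) x).mul
          (((hasDerivAt_id x).const_sub 1).pow (j + 1))
        refine h.congr_deriv ?_
        simp only [Nat.add_sub_cancel, id_eq, Pi.pow_apply]
        push_cast; ring
      · exact Continuous.intervalIntegrable (by fun_prop) _ _
    have h := ih (k + 1)
    have hch : ((k + (j + 1) + 1).choose k : ℝ) * ((j : ℝ) + 2) =
        ((k + 1 + j + 1).choose (k + 1) : ℝ) * ((k : ℝ) + 1) := by
      have := Nat.choose_succ_right_eq (k + j + 2) k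
      rw [show k + j + 2 - k = j + 2 by omega] at this
      rw [show k + (j + 1) + 1 = k + j + 2 by ring, show k + 1 + j + 1 = k + j + 2 by ring]
      exact_mod_cast this.symm
    have e : (((j + 1 : ℕ) : ℝ) + 1) = (j : ℝ) + 2 := by push_cast; ring
    rw [e, mul_comm ((j : ℝ) + 2), hch, mul_assoc, sub_eq_zero.1 hparts]
    linarith

/-- The probability measure with density `(j + 1) (1 - s) ^ j` on the unit interval. -/
noncomputable def unitPowerMeasure (j : ℕ) : Measure ℝ :=
  (volume.restrict (Ioc 0 1)).withDensity
    fun s => ENNReal.ofReal (((j : ℝ) + 1) * (1 - s) ^ j)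

instance (j : ℕ) : SFinite (unitPowerMeasure j) := by
  unfold unitPowerMeasure; infer_instance

theorem ae_unitPowerMeasure_mem (j : ℕ) : ∀ᵐ s ∂unitPowerMeasure j, s ∈ Ioc (0 : ℝ) 1 :=
  (withDensity_absolutelyContinuous _ _).ae_le (ae_restrict_mem measurableSet_Ioc)

/-- The tail is the factor by which volume in dimension `j + 1` shrinks under scaling by `1 - c`. -/
theorem unitPowerMeasure_Ici (j : ℕ) {c : ℝ} (hc : c ∈ Icc (0 : ℝ) 1) :
    unitPowerMeasure j (Ici c) = ENNReal.ofReal ((1 - c) ^ (j + 1)) := by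
  have hnonneg : ∀ s ∈ Ioc c 1, 0 ≤ ((j : ℝ) + 1) * (1 - s) ^ j := fun s hs => by
    have := sub_nonneg.2 hs.2
    positivity
  have hset : (Ici c ∩ Ioc 0 1 : Set ℝ) =ᵐ[volume] Ioc c 1 := by
    have : (Ici c ∩ Ioc 0 1 : Set ℝ) =ᵐ[volume] (Ioi c ∩ Ioc 0 1 : Set ℝ) :=
      Ioi_ae_eq_Ici.symm.inter (ae_eq_refl _)
    have hIoc : (Ioi c ∩ Ioc 0 1 : Set ℝ) = Ioc c 1 := by
      ext s
      simp only [mem_inter_iff, mem_Ioi, mem_Ioc]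
      exact ⟨fun h => ⟨h.1, h.2.2⟩, fun h => ⟨h.1, lt_of_le_of_lt hc.1 h.1, h.2⟩⟩
    rwa [hIoc] at this
  have hint : ∫ s in c..1, ((j : ℝ) + 1) * (1 - s) ^ j = (1 - c) ^ (j + 1) := by
    rw [intervalIntegral.integral_eq_sub_of_hasDerivAt
      (f := fun s : ℝ => -(1 - s) ^ (j + 1))]
    · simp
    · intro s _
      refine (((hasDerivAt_id s).const_sub 1).pow (j + 1)).neg.congr_deriv ?_
      simp only [Nat.add_sub_cancel, id_eq]
      push_cast; ring
    · exact Continuous.intervalIntegrable (by fun_prop) _ _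
  rw [unitPowerMeasure, withDensity_apply _ measurableSet_Ici,
    Measure.restrict_restrict measurableSet_Ici, setLIntegral_congr hset,
    ← ofReal_integral_eq_lintegral_ofReal, ← intervalIntegral.integral_of_le hc.2, hint]
  · exact (Continuous.integrableOn_Icc (by fun_prop)).mono_set Ioc_subset_Icc_self
  · exact (ae_restrict_iff' measurableSet_Ioc).2 (ae_of_all _ hnonneg)

theorem lintegral_pow_unitPowerMeasure (j k : ℕ) :
    ((k + j + 1).choose k : ℝ≥0∞) * ∫⁻ s, ENNReal.ofReal (s ^ k) ∂unitPowerMeasure j = 1 := by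
  have hnonneg : ∀ s ∈ Ioc (0 : ℝ) 1, 0 ≤ ((j : ℝ) + 1) * (1 - s) ^ j * s ^ k := fun s hs => by
    have := sub_nonneg.2 hs.2
    have := hs.1
    positivity
  have h1 : ∫⁻ s, ENNReal.ofReal (s ^ k) ∂unitPowerMeasure j =
      ENNReal.ofReal (∫ s in (0 : ℝ)..1, ((j : ℝ) + 1) * (1 - s) ^ j * s ^ k) := by
    rw [unitPowerMeasure, lintegral_withDensity_eq_lintegral_mul _ (by fun_prop) (by fun_prop),
      intervalIntegral.integral_of_le zero_le_one, ofReal_integral_eq_lintegral_ofReal]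
    · refine setLIntegral_congr_fun measurableSet_Ioc fun s hs => ?_
      have := sub_nonneg.2 hs.2
      simp only [Pi.mul_apply]
      rw [← ENNReal.ofReal_mul (by positivity)]
    · exact (Continuous.integrableOn_Icc (by fun_prop)).mono_set Ioc_subset_Icc_self
    · exact (ae_restrict_iff' measurableSet_Ioc).2 (ae_of_all _ hnonneg)
  rw [h1, ← ENNReal.ofReal_natCast, ← ENNReal.ofReal_mul (Nat.cast_nonneg _),
    ← ENNReal.ofReal_one]
  congr 1
  refine Eq.trans ?_ (integral_pow_mul_one_sub_pow j k)
  rw [mul_comm ((j : ℝ) + 1), mul_assoc, ← intervalIntegral.integral_const_mul,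
    ← intervalIntegral.integral_const_mul, ← intervalIntegral.integral_const_mul]
  congr 1
  funext s
  ring

variable {E : Type*} [NormedAddCommGroup E] [InnerProductSpace ℝ E] [FiniteDimensional ℝ E]
  [MeasurableSpace E] [BorelSpace E]

/-- If `x` is `s` times the projection of `q ∈ L`, convexity puts `s q + (1 - s) y` in `L` for each
`y` in the central section, so the fibre over `x` contains a translate of that section scaled by `1
- s`. -/
theorem volume_section_ge (U : Submodule ℝ E) {L : Set E} (hc : Convex ℝ L) {x : U} {s : ℝ}
    (hs : s ∈ Icc (0 : ℝ) 1) (hx : x ∈ s • (U.orthogonalProjectionOnto '' L)) :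
    ENNReal.ofReal ((1 - s) ^ Module.finrank ℝ Uᗮ) * volume ((↑) ⁻¹' L : Set Uᗮ) ≤
      volume {y : Uᗮ | (x : E) + y ∈ L} := by
  obtain ⟨_, ⟨q, hq, rfl⟩, rfl⟩ := hx
  have h1 : 0 ≤ 1 - s := sub_nonneg.2 hs.2
  have hsub : (fun y => s • Uᗮ.orthogonalProjectionOnto q + y) ''
      ((1 - s) • ((↑) ⁻¹' L : Set Uᗮ)) ⊆
      {y : Uᗮ | ((s • U.orthogonalProjectionOnto q : U) : E) + y ∈ L} := by
    rintro _ ⟨_, ⟨y, hy, rfl⟩, rfl⟩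
    have := hc hq hy hs.1 h1 (by ring)
    rw [mem_ofPred_eq]
    convert this using 1
    nth_rw 3 [← U.coe_orthogonalProjectionOnto_add q]
    simp only [Submodule.coe_add, Submodule.coe_smul]
    module
  refine le_trans (le_of_eq ?_) (measure_mono hsub)
  rw [image_add_left, measure_preimage_add, Measure.addHaar_smul, abs_of_nonneg (by positivity)]

theorem volume_eq_lintegral_section (U : Submodule ℝ E) {L : Set E} (hL : MeasurableSet L) :
    volume L = ∫⁻ x : U, volume {y : Uᗮ | (x : E) + y ∈ L} := by
  rw [← lintegral_indicator_one hL,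
    lintegral_eq_lintegral_orthogonal U (measurable_one.indicator hL)]
  refine lintegral_congr fun x => ?_
  rw [← lintegral_indicator_one]
  · rfl
  · exact hL.preimage (by fun_prop)

/-- The Rogers–Shephard inequality for a section and the complementary projection. -/
theorem volume_projection_mul_volume_section_le (U : Submodule ℝ E) {L : Set E} (hL : IsCompact L)
    (hc : Convex ℝ L) :
    volume (U.orthogonalProjectionOnto '' L) * volume ((↑) ⁻¹' L : Set Uᗮ) ≤
      (Module.finrank ℝ E).choose (Module.finrank ℝ U) * volume L := by
  set P := U.orthogonalProjectionOnto '' L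
  have hP : IsCompact P := hL.image U.orthogonalProjectionOnto.continuous
  have hQ : IsCompact ((↑) ⁻¹' L : Set Uᗮ) :=
    (Submodule.closed_of_finiteDimensional Uᗮ).isClosedEmbedding_subtypeVal.isCompact_preimage hL
  have hQfin := hQ.measure_lt_top (μ := (volume : Measure Uᗮ)).ne
  rw [volume_eq_lintegral_section U hL.measurableSet, ← U.finrank_add_finrank_orthogonal]
  rcases hm : Module.finrank ℝ Uᗮ with _ | j
  -- When `Uᗮ` is trivial there is no density `(j + 1)(1 - s)^j` to use; comparing fibres at `s = 1`
  -- suffices.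
  · rw [add_zero, Nat.choose_self, Nat.cast_one, one_mul, mul_comm, ← setLIntegral_const]
    refine (setLIntegral_mono' hP.measurableSet fun x hx => ?_).trans (setLIntegral_le_lintegral P _)
    have := volume_section_ge U hc (x := x) (s := 1) (right_mem_Icc.2 zero_le_one)
      (by rwa [one_smul])
    simpa [hm] using this
  -- The set `x ∈ s P` is measured in two ways. Slices at fixed `s` have volume `s^k vol P`, where
  -- `k = dim U`, and integrate to `vol P` over the binomial coefficient. Slices at fixed `x` have a
  -- measure which, times the volume of the central section, is at most the volume of the fibre over
  -- `x`.
  · have hT : MeasurableSet {z : U × ℝ | z.2 ∈ Icc (0 : ℝ) 1 ∧ z.1 ∈ z.2 • P} := by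
      have hcomp : IsCompact ((fun w : ℝ × U => (w.1 • w.2, w.1)) '' (Icc (0 : ℝ) 1 ×ˢ P)) :=
        (isCompact_Icc.prod hP).image (by fun_prop)
      convert hcomp.measurableSet using 1
      ext ⟨x, s⟩
      constructor
      · rintro ⟨hs, p, hp, hx⟩
        exact ⟨(s, p), ⟨hs, hp⟩, Prod.ext hx rfl⟩
      · rintro ⟨⟨s', p⟩, ⟨hs, hp⟩, h⟩
        obtain ⟨rfl, rfl⟩ := Prod.mk.inj h
        exact ⟨hs, p, hp, rfl⟩
    have h1 := Measure.prod_apply (μ := (volume : Measure U)) (ν := unitPowerMeasure j) hT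
    rw [Measure.prod_apply_symm hT] at h1
    have h2 : ∫⁻ s, volume ((fun x : U => (x, s)) ⁻¹'
          {z : U × ℝ | z.2 ∈ Icc (0 : ℝ) 1 ∧ z.1 ∈ z.2 • P}) ∂unitPowerMeasure j =
        (∫⁻ s, ENNReal.ofReal (s ^ Module.finrank ℝ U) ∂unitPowerMeasure j) * volume P := by
      rw [← lintegral_mul_const _ (by fun_prop)]
      refine lintegral_congr_ae ?_
      filter_upwards [ae_unitPowerMeasure_mem j] with s hs
      have : (fun x : U => (x, s)) ⁻¹' {z : U × ℝ | z.2 ∈ Icc (0 : ℝ) 1 ∧ z.1 ∈ z.2 • P} =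
          s • P := by
        ext x
        exact ⟨fun h => h.2, fun h => ⟨Ioc_subset_Icc_self hs, h⟩⟩
      rw [this, Measure.addHaar_smul, abs_of_nonneg (pow_nonneg hs.1.le _)]
    have h3 : ∀ x : U, unitPowerMeasure j (Prod.mk x ⁻¹'
          {z : U × ℝ | z.2 ∈ Icc (0 : ℝ) 1 ∧ z.1 ∈ z.2 • P}) * volume ((↑) ⁻¹' L : Set Uᗮ) ≤
        volume {y : Uᗮ | (x : E) + y ∈ L} := by
      intro x
      set S : Set ℝ := Prod.mk x ⁻¹' {z : U × ℝ | z.2 ∈ Icc (0 : ℝ) 1 ∧ z.1 ∈ z.2 • P}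
      rcases S.eq_empty_or_nonempty with hS | hS
      · simp [hS]
      have hbdd : BddBelow S := ⟨0, fun s hs => hs.1.1⟩
      -- The fibre estimate is a closed condition on `s`, so it passes to the infimum whether or not
      -- that is attained, and `S` lies in the tail starting there.
      have hcl : sInf S ∈ closure S := csInf_mem_closure hS hbdd
      have hsub : S ⊆ {s | s ∈ Icc (0 : ℝ) 1 ∧ ENNReal.ofReal ((1 - s) ^ (j + 1)) *
          volume ((↑) ⁻¹' L : Set Uᗮ) ≤ volume {y : Uᗮ | (x : E) + y ∈ L}} := by
        intro s hs
        refine ⟨hs.1, ?_⟩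
        rw [← hm]
        exact volume_section_ge U hc hs.1 hs.2
      have hclosed : IsClosed {s | s ∈ Icc (0 : ℝ) 1 ∧ ENNReal.ofReal ((1 - s) ^ (j + 1)) *
          volume ((↑) ⁻¹' L : Set Uᗮ) ≤ volume {y : Uᗮ | (x : E) + y ∈ L}} := by
        refine IsClosed.inter (s₁ := Icc (0 : ℝ) 1)
          (s₂ := {s | ENNReal.ofReal ((1 - s) ^ (j + 1)) * volume ((↑) ⁻¹' L : Set Uᗮ) ≤
            volume {y : Uᗮ | (x : E) + y ∈ L}}) isClosed_Icc (isClosed_le ?_ continuous_const)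
        exact (ENNReal.continuous_mul_const hQfin).comp
          (ENNReal.continuous_ofReal.comp (by fun_prop))
      obtain ⟨hc1, hc2⟩ := closure_minimal hsub hclosed hcl
      refine le_trans ?_ hc2
      gcongr
      rw [← unitPowerMeasure_Ici j hc1]
      exact measure_mono fun s hs => csInf_le hbdd hs
    calc volume P * volume ((↑) ⁻¹' L : Set Uᗮ)
        = ((Module.finrank ℝ U + j + 1).choose (Module.finrank ℝ U) : ℝ≥0∞) *
            ((∫⁻ s, ENNReal.ofReal (s ^ Module.finrank ℝ U) ∂unitPowerMeasure j) * volume P *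
              volume ((↑) ⁻¹' L : Set Uᗮ)) := by
          rw [← mul_assoc, ← mul_assoc, lintegral_pow_unitPowerMeasure, one_mul]
      _ ≤ _ := by
          rw [← add_assoc]
          gcongr
          rw [← h2, h1, ← lintegral_mul_const']
          · exact lintegral_mono h3
          · exact hQfin

/-! ### Chebyshev's integral inequality and the binomial bound -/

theorem ENNReal.mul_add_mul_le_mul_add_mul {a b c d : ℝ≥0∞} (hab : a ≤ b) (hcd : c ≤ d) :
    a * d + b * c ≤ a * c + b * d := by
  obtain ⟨e, rfl⟩ := exists_add_of_le hab
  obtain ⟨h, rfl⟩ := exists_add_of_le hcd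
  exact le_iff_exists_add.2 ⟨e * h, by ring⟩

/-- Integrate `(f s - f t)(g s - g t) ≥ 0` over both variables, rearranged to avoid subtraction in
`[0, ∞]`. -/
theorem lintegral_mul_lintegral_le_of_monotone {μ : Measure ℝ} [IsProbabilityMeasure μ]
    {f g : ℝ → ℝ≥0∞} (hf : Monotone f) (hg : Monotone g) :
    (∫⁻ t, f t ∂μ) * ∫⁻ t, g t ∂μ ≤ ∫⁻ t, f t * g t ∂μ := by
  have hfm := hf.measurable
  have hgm := hg.measurable
  have hpt : ∀ s t, f s * g t + f t * g s ≤ f s * g s + f t * g t := by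
    intro s t
    rcases le_total s t with h | h
    · exact ENNReal.mul_add_mul_le_mul_add_mul (hf h) (hg h)
    · rw [add_comm (f s * g t), add_comm (f s * g s)]
      exact ENNReal.mul_add_mul_le_mul_add_mul (hf h) (hg h)
  have hleft : ∫⁻ s, ∫⁻ t, f s * g t + f t * g s ∂μ ∂μ =
      2 * ((∫⁻ t, f t ∂μ) * ∫⁻ t, g t ∂μ) := by
    have : ∀ s, ∫⁻ t, f s * g t + f t * g s ∂μ =
        f s * ∫⁻ t, g t ∂μ + (∫⁻ t, f t ∂μ) * g s := fun s => by
      rw [lintegral_add_left (hgm.const_mul _), lintegral_const_mul _ hgm,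
        lintegral_mul_const _ hfm]
    simp_rw [this]
    rw [lintegral_add_left (hfm.mul_const _), lintegral_mul_const _ hfm,
      lintegral_const_mul _ hgm, two_mul]
  have hright : ∫⁻ s, ∫⁻ t, f s * g s + f t * g t ∂μ ∂μ = 2 * ∫⁻ t, f t * g t ∂μ := by
    have : ∀ s, ∫⁻ t, f s * g s + f t * g t ∂μ = f s * g s + ∫⁻ t, f t * g t ∂μ := fun s => by
      rw [lintegral_add_left measurable_const, lintegral_const, measure_univ, mul_one]
    simp_rw [this]
    rw [lintegral_add_right _ measurable_const, lintegral_const, measure_univ, mul_one, two_mul]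
  have h : 2 * ((∫⁻ t, f t ∂μ) * ∫⁻ t, g t ∂μ) ≤ 2 * ∫⁻ t, f t * g t ∂μ := by
    rw [← hleft, ← hright]
    exact lintegral_mono fun s => lintegral_mono fun t => hpt s t
  exact (ENNReal.mul_le_mul_iff_right two_ne_zero ENNReal.ofNat_ne_top).1 h

theorem willsIntegral_projection_mul_section_le_choose (U : Submodule ℝ E) {K : Set E}
    (hK : IsCompact K) (hc : Convex ℝ K) (hQ : ((↑) ⁻¹' K : Set Uᗮ).Nonempty) :
    willsIntegral (U.orthogonalProjectionOnto '' K) * willsIntegral ((↑) ⁻¹' K : Set Uᗮ) ≤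
      (Module.finrank ℝ E).choose (Module.finrank ℝ U) * willsIntegral K := by
  have hne : K.Nonempty := ⟨_, hQ.some_mem⟩
  rw [willsIntegral_eq_lintegral (hne.image _), willsIntegral_eq_lintegral hQ,
    willsIntegral_eq_lintegral hne]
  refine (lintegral_mul_lintegral_le_of_monotone (monotone_volume_cthickening _)
    (monotone_volume_cthickening _)).trans ?_
  rw [← lintegral_const_mul' _ _ (ENNReal.natCast_ne_top _)]
  refine lintegral_mono_ae ?_
  filter_upwards [ae_rayleighMeasure_pos] with t ht
  refine le_trans ?_ (volume_projection_mul_volume_section_le U (hK.cthickening (r := t))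
    (hc.cthickening t))
  -- The parallel body of the projection lies in the projection of the parallel body, by lifting
  -- points; the parallel body of the section lies in the section of the parallel body, since
  -- distance to a subset is larger.
  gcongr
  · intro x hx
    rw [Metric.mem_cthickening_iff_infDist_le (hne.image _) ht.le] at hx
    obtain ⟨v, hv⟩ := exists_infDist_add_le U hne hK x
    refine ⟨(x : E) + v, (Metric.mem_cthickening_iff_infDist_le hne ht.le).2 (hv.trans hx), ?_⟩
    rw [map_add, Submodule.orthogonalProjectionOnto_mem_subspace_eq_self,
      Submodule.orthogonalProjectionOnto_eq_zero_iff.2 v.2, add_zero]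
  · intro y hy
    rw [Metric.mem_cthickening_iff_infDist_le hQ ht.le] at hy
    refine (Metric.mem_cthickening_iff_infDist_le hne ht.le).2 (le_trans ?_ hy)
    rw [Metric.le_infDist hQ]
    exact fun q hq => Metric.infDist_le_dist_of_mem hq

end RogersShephard

/-! ### The two bounds for the Wills functional -/

theorem theorem1p8 {n k : ℕ} (K : ConvexBody (EuclideanSpace ℝ (Fin n)))
    (hK : (0 : EuclideanSpace ℝ (Fin n)) ∈ K)
    (H : Submodule ℝ (EuclideanSpace ℝ (Fin n))) (hH : Module.finrank ℝ H = k) :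
    willsFunctional (H.starProjection '' (K : Set (EuclideanSpace ℝ (Fin n)))) *
        willsFunctional ((K : Set (EuclideanSpace ℝ (Fin n))) ∩ (Hᗮ : Set _)) ≤
      min ((n.choose k : ℝ) * willsFunctional (K : Set (EuclideanSpace ℝ (Fin n))))
        ((2 : ℝ) ^ ((n : ℝ) / 2) *
          willsFunctional (Real.sqrt 2 • (K : Set (EuclideanSpace ℝ (Fin n))))) := by
  set C : Set (EuclideanSpace ℝ (Fin n)) := (K : Set (EuclideanSpace ℝ (Fin n)))
  have h0 : (0 : EuclideanSpace ℝ (Fin n)) ∈ C := hK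
  have hCne : C.Nonempty := ⟨0, h0⟩
  have hCc : IsCompact C := K.isCompact
  have hCv : Convex ℝ C := K.convex
  have hQne : ((↑) ⁻¹' C : Set Hᗮ).Nonempty := ⟨0, h0⟩
  have hHc : IsClosed (Hᗮ : Set (EuclideanSpace ℝ (Fin n))) :=
    Submodule.closed_of_finiteDimensional Hᗮ
  have hQ : IsCompact ((↑) ⁻¹' C : Set Hᗮ) :=
    hHc.isClosedEmbedding_subtypeVal.isCompact_preimage hCc
  have e1 : H.starProjection '' C = (↑) '' (H.orthogonalProjectionOnto '' C) := by
    rw [← Set.image_comp]; rfl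
  have e2 : C ∩ (Hᗮ : Set _) = (↑) '' ((↑) ⁻¹' C : Set Hᗮ) := by
    rw [Set.inter_comm]; exact (Subtype.image_preimage_coe (Hᗮ : Set _) C).symm
  obtain ⟨p1, w1⟩ := willsIntegral_eq_willsFunctional (hCne.image H.starProjection)
    (hCc.image H.starProjection.continuous)
    (hCv.linear_image H.starProjection.toLinearMap)
  obtain ⟨p2, w2⟩ := willsIntegral_eq_willsFunctional (K := C ∩ (Hᗮ : Set _))
    ⟨0, h0, Hᗮ.zero_mem⟩ (hCc.inter_right hHc) (hCv.inter Hᗮ.convex)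
  obtain ⟨p3, w3⟩ := willsIntegral_eq_willsFunctional hCne hCc hCv
  obtain ⟨p4, w4⟩ := willsIntegral_eq_willsFunctional (hCne.smul_set (a := Real.sqrt 2))
    (hCc.smul (Real.sqrt 2)) (hCv.smul (Real.sqrt 2))
  -- The functionals are taken in `ℝ^n`, but the integral inequalities live in `H` and `Hᗮ`;
  -- independence of the ambient dimension links them.
  rw [e1, willsIntegral_coe_image H (hCne.image _)
    (hCc.image H.orthogonalProjectionOnto.continuous), ← e1] at w1
  rw [e2, willsIntegral_coe_image Hᗮ hQne hQ, ← e2] at w2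
  refine le_min ?_ ?_
  · have h := willsIntegral_projection_mul_section_le_choose H hCc hCv hQne
    rw [w1, w2, w3, hH, finrank_euclideanSpace_fin, ← ENNReal.ofReal_mul p1,
      ← ENNReal.ofReal_natCast, ← ENNReal.ofReal_mul (Nat.cast_nonneg _)] at h
    exact (ENNReal.ofReal_le_ofReal_iff (by positivity)).1 h
  · have h := willsIntegral_projection_mul_section_le H hCc hCv hQne
    rw [lintegral_exp_infDist_half, w1, w2, w4, finrank_euclideanSpace_fin,
      ← ENNReal.ofReal_mul p1, ← ENNReal.ofReal_mul (by positivity)] at h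
    exact (ENNReal.ofReal_le_ofReal_iff (by positivity)).1 h
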